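/- **Proposition (strongly orthogonal roots in $\mathrm{E}_8$).** Let $e_1,\dots,e_8$ be the standard orthonormal basis of $\mathbb{R}^8$, and for $I\subseteq\{1,\dots,8\}$ put $\zeta_I=\tfrac12\big(\sum_{i\in I}e_i-\sum_{i\notin I}e_i\big)$. Let $$\mathcal{R}=\{\pm e_i\pm e_j \mid 1\le i<j\le 8\}\cup\{\zeta_I \mid \#I \text{ even}\}$$ be the root system of type $\mathrm{E}_8$. For $v\neq0$ let $s_v(x)=x-\frac{2(x\mid v)}{(v\mid v)}v$, and let $W$ be the Weyl group, i.e. the group of isometries of $\mathbb{R}^8$ generated by the $s_\alpha$, $\alpha\in\mathcal{R}$. Two roots $\alpha,\beta$ with $\alpha\neq\pm\beta$ are *strongly orthogonal* if neither $\alpha+\beta$ nor $\alpha-\beta$ is a root. A *system of strongly orthogonal roots* is a finite set of roots, any two distinct elements of which are strongly orthogonal. Two systems $S,S'$ are *equivalent* if $w(S)=S'$ for some $w\in W$. For pairwise orthogonal nonzero vectors $v_1,v_2,v_3,v_4$ of equal length let $K_4(v_1,v_2,v_3,v_4)$ be the Klein $4$-group of isometries of $\mathbb{R}^8$ consisting of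 $$\mathrm{id},\quad s_{v_1-v_2}\circ s_{v_3-v_4},\quad s_{v_1-v_3}\circ s_{v_2-v_4},\quad s_{v_1-v_4}\circ s_{v_2-v_3}.$$ 1. For every integer $k\ge0$ with $k\neq4$, any two systems of $k$ strongly orthogonal roots of $\mathcal{R}$ are equivalent. 2. There are exactly two equivalence classes of systems $\{\alpha_1,\alpha_2,\alpha_3,\alpha_4\}$ of four strongly orthogonal roots of $\mathcal{R}$: class (I) consists of those with $K_4(\alpha_1,\alpha_2,\alpha_3,\alpha_4)\subseteq W$, and class (II) of those with $K_4(\alpha_1,\alpha_2,\alpha_3,\alpha_4)\not\subseteq W$. That is, both kinds occur, and two such systems, enumerated in any order, are equivalent if and only if they are of the same kind. -/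

import Mathlib

open scoped RealInnerProductSpace

namespace E8

/-- The Euclidean space `ℝ⁸`, with orthonormal basis `e 0, …, e 7`. -/
abbrev V : Type := EuclideanSpace ℝ (Fin 8)

/-- The standard orthonormal basis vectors. -/
noncomputable def e (i : Fin 8) : V := EuclideanSpace.single i 1

/-- The vector `ζ_I = ½ (∑_{i ∈ I} e_i - ∑_{i ∉ I} e_i)`. -/
noncomputable def zeta (I : Finset (Fin 8)) : V :=
  (1 / 2 : ℝ) • (∑ i ∈ I, e i - ∑ i ∈ Iᶜ, e i)

/-- The root system `E₈`: the 112 vectors `± e_i ± e_j` with `i ≠ j`, and the 128 vectors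
`ζ_I` with `#I` even (these are `± ζ_∅`, `± ζ_{i,j}` and `ζ_{i,j,h,k}`, since
`- ζ_I = ζ_{Iᶜ}`). -/
def roots : Set V :=
  {v | ∃ i j : Fin 8, i ≠ j ∧ (v = e i + e j ∨ v = e i - e j ∨ v = -e i - e j)} ∪
  {v | ∃ I : Finset (Fin 8), Even I.card ∧ v = zeta I}

/-- The orthogonal reflection `s_v` of `ℝ⁸` in the hyperplane perpendicular to `v`. -/
noncomputable def refl (v : V) : V ≃ₗᵢ[ℝ] V := (ℝ ∙ v)ᗮ.reflection

theorem refl_apply (v x : V) : refl v x = x - (2 * ⟪x, v⟫ / ⟪v, v⟫) • v := by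
  rw [refl, Submodule.reflection_orthogonal_apply, Submodule.reflection_singleton_apply,
    real_inner_comm v x, real_inner_self_eq_norm_sq]
  simp only [RCLike.ofReal_real_eq_id, id_eq, two_smul, two_mul, add_div, add_smul]
  abel

/-- The Weyl group of `E₈`: the group of isometries generated by the root reflections. -/
noncomputable def weylGroup : Subgroup (V ≃ₗᵢ[ℝ] V) := Subgroup.closure (refl '' roots)

/-- Strong orthogonality of two roots: they are not proportional, and neither their sum nor
their difference is a root. -/
def StronglyOrthogonal (α β : V) : Prop :=
  α ≠ β ∧ α ≠ -β ∧ α + β ∉ roots ∧ α - β ∉ roots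

/-- A system of strongly orthogonal roots: a finite set of roots, any two distinct members of
which are strongly orthogonal. -/
def IsStronglyOrthogonalSystem (S : Finset V) : Prop :=
  (S : Set V) ⊆ roots ∧ (S : Set V).Pairwise StronglyOrthogonal

/-- Two sets of vectors are equivalent if an element of the Weyl group maps the first onto the
second. -/
def WeylEquivalent (S T : Set V) : Prop := ∃ w ∈ weylGroup, w '' S = T

/-- The set of four isometries
`id, s_{v₀-v₁} ∘ s_{v₂-v₃}, s_{v₀-v₂} ∘ s_{v₁-v₃}, s_{v₀-v₃} ∘ s_{v₁-v₂}`.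
For pairwise orthogonal nonzero vectors of the same length it is the Klein four-group which
permutes these vectors by the identity and the three double transpositions, and fixes their
orthogonal complement pointwise. -/
noncomputable def klein (v : Fin 4 → V) : Set (V ≃ₗᵢ[ℝ] V) :=
  {1, refl (v 0 - v 1) * refl (v 2 - v 3), refl (v 0 - v 2) * refl (v 1 - v 3),
    refl (v 0 - v 3) * refl (v 1 - v 2)}

/-- An enumeration, without repetitions, of a system of four strongly orthogonal roots. -/
def IsStronglyOrthogonalQuadruple (α : Fin 4 → V) : Prop :=
  (∀ i, α i ∈ roots) ∧ Pairwise fun i j => StronglyOrthogonal (α i) (α j)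

end E8

/-! The roots are the norm-two vectors of an integral lattice, so two non-proportional roots have
inner product 0, 1 or -1, and strong orthogonality is just orthogonality (`stronglyOrthogonal_iff`).
Two roots `x`, `y` that are both non-orthogonal to some root `g` are conjugate under reflections
fixing every vector orthogonal to `x`, `y` and `g` (`exists_weyl_apply_eq`).

This moves orthogonal roots, one at a time, into a fixed frame of eight orthogonal roots. The roots
orthogonal to none, one or two of the first frame vectors form systems of type E₈, E₇, D₆. All are
irreducible, so ordered triples form one orbit. The roots orthogonal to three form A₁ + D₄, and a
fourth root lies in either summand: this gives at most two orbits of quadruples. Half the sum of the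
quadruple, which depends only on the underlying set, is a root in the A₁ case and not in the D₄
case, and this matches the Klein group lying in the Weyl group or not
(`klein_subset_iff_half_sum_mem`).

With five or more roots, some root beyond the first three lies in D₄. The roots orthogonal to these
four form A₁⁴ and belong to the frame up to sign, so the whole system does. Sign changes and double
transpositions of the frame then bring it to a standard subset
(`weylEquivalent_standard_of_five_le`). -/

namespace E8

/-! ### Roots as norm-two vectors of the lattice -/

/-- The `E₈` lattice: the vectors whose coordinates are all integers or all proper half-integers,
with even sum of coordinates. -/
def lattice : AddSubgroup V where
  carrier := {x | ∃ (a b : ℤ) (m : Fin 8 → ℤ), (∀ i, x i = a / 2 + m i) ∧ ∑ i, m i = 2 * b}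
  zero_mem' := ⟨0, 0, 0, by simp, by simp⟩
  add_mem' := by
    rintro x y ⟨a, b, m, h, hs⟩ ⟨a', b', m', h', hs'⟩
    refine ⟨a + a', b + b', m + m', fun i => ?_, ?_⟩
    · simp only [PiLp.add_apply, h, h', Pi.add_apply]; push_cast; ring
    · simp only [Pi.add_apply, Finset.sum_add_distrib, hs, hs']; ring
  neg_mem' := by
    rintro x ⟨a, b, m, h, hs⟩
    refine ⟨-a, -b, -m, fun i => ?_, ?_⟩
    · simp only [PiLp.neg_apply, h, Pi.neg_apply]; push_cast; ring
    · simp only [Pi.neg_apply, Finset.sum_neg_distrib, hs]; ring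

theorem mem_lattice {x : V} : x ∈ lattice ↔
    ∃ (a b : ℤ) (m : Fin 8 → ℤ), (∀ i, x i = a / 2 + m i) ∧ ∑ i, m i = 2 * b := Iff.rfl

theorem inner_eq_sum (x y : V) : ⟪x, y⟫ = ∑ i, x i * y i := by
  simp [PiLp.inner_apply, mul_comm]

theorem e_apply (i j : Fin 8) : e i j = if j = i then 1 else 0 := by
  simp [e]

theorem inner_e (x : V) (i : Fin 8) : ⟪e i, x⟫ = x i := by
  simp [inner_eq_sum, e_apply]

theorem zeta_apply (I : Finset (Fin 8)) (i : Fin 8) :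
    zeta I i = if i ∈ I then 1 / 2 else -(1 / 2) := by
  simp only [zeta, PiLp.smul_apply, PiLp.sub_apply, WithLp.ofLp_sum, Finset.sum_apply, e_apply,
    Finset.sum_ite_eq, Finset.mem_compl, smul_eq_mul]
  split_ifs <;> simp_all

/-- Inner products of vectors of the `E₈` lattice are integers. -/
theorem exists_int_inner_eq {x y : V} (hx : x ∈ lattice) (hy : y ∈ lattice) :
    ∃ n : ℤ, ⟪x, y⟫ = n := by
  obtain ⟨a, b, m, h, hs⟩ := hx
  obtain ⟨a', b', m', h', hs'⟩ := hy
  refine ⟨2 * a * a' + a * b' + a' * b + ∑ i, m i * m' i, ?_⟩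
  have hs : ∑ i, (m i : ℝ) = 2 * b := by exact_mod_cast hs
  have hs' : ∑ i, (m' i : ℝ) = 2 * b' := by exact_mod_cast hs'
  have key : ∀ i, x i * y i = a * a' / 4 + a / 2 * m' i + a' / 2 * m i + m i * m' i := by
    intro i; rw [h, h']; ring
  simp only [inner_eq_sum, key, Finset.sum_add_distrib, ← Finset.mul_sum, hs, hs']
  simp
  ring

theorem e_add_e_mem_roots {i j : Fin 8} (h : i ≠ j) : e i + e j ∈ roots :=
  Or.inl ⟨i, j, h, Or.inl rfl⟩

theorem e_sub_e_mem_roots {i j : Fin 8} (h : i ≠ j) : e i - e j ∈ roots :=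
  Or.inl ⟨i, j, h, Or.inr (Or.inl rfl)⟩

theorem zeta_mem_roots {I : Finset (Fin 8)} (h : Even I.card) : zeta I ∈ roots :=
  Or.inr ⟨I, h, rfl⟩

theorem mem_lattice_of_mem_roots {x : V} (hx : x ∈ roots) : x ∈ lattice := by
  have int_case : ∀ (m : Fin 8 → ℤ) (b : ℤ), (∀ i, x i = m i) → ∑ i, m i = 2 * b →
      x ∈ lattice := fun m b h hs => ⟨0, b, m, by simpa using h, hs⟩
  rcases hx with ⟨i, j, hij, rfl | rfl | rfl⟩ | ⟨I, ⟨b, hb⟩, rfl⟩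
  · refine int_case (Pi.single i 1 + Pi.single j 1) 1 (fun k => ?_) ?_
    · simp [e_apply, Pi.single_apply]
    · simp [Finset.sum_add_distrib]
  · refine int_case (Pi.single i 1 - Pi.single j 1) 0 (fun k => ?_) ?_
    · simp [e_apply, Pi.single_apply]
    · simp [Finset.sum_sub_distrib]
  · refine int_case (-Pi.single i 1 - Pi.single j 1) (-1) (fun k => ?_) ?_
    · simp [e_apply, Pi.single_apply]
    · simp [Finset.sum_sub_distrib]
  -- `ζ_I` is the constant vector -1/2 plus the indicator of `I`.
  · refine ⟨-1, b, fun i => if i ∈ I then 1 else 0, fun i => ?_, ?_⟩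
    · rw [zeta_apply]; split_ifs with h <;> norm_num [h]
    · simp [hb]; ring

theorem inner_self_of_mem_roots {x : V} (hx : x ∈ roots) : ⟪x, x⟫ = 2 := by
  rcases hx with ⟨i, j, hij, rfl | rfl | rfl⟩ | ⟨I, -, rfl⟩
  · rw [inner_add_left, inner_e, inner_e]; simp [e_apply, hij, hij.symm]; norm_num
  · rw [inner_sub_left, inner_e, inner_e]; simp [e_apply, hij, hij.symm]; norm_num
  · rw [inner_sub_left, inner_neg_left, inner_e, inner_e]; simp [e_apply, hij, hij.symm]; norm_num
  · have : ∀ i, zeta I i * zeta I i = 1 / 4 := by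
      intro i; rw [zeta_apply]; split_ifs <;> norm_num
    rw [inner_eq_sum, Finset.sum_congr rfl fun i _ => this i]; simp; norm_num

/-- An integral vector of squared norm two has exactly two nonzero coordinates, equal to `±1`. -/
theorem exists_of_sum_sq_eq_two {n : Fin 8 → ℤ} (h : ∑ i, n i ^ 2 = 2) :
    ∃ i j, i ≠ j ∧ (n i = 1 ∨ n i = -1) ∧ (n j = 1 ∨ n j = -1) ∧
      ∀ k, k ≠ i → k ≠ j → n k = 0 := by
  have unit : ∀ z : ℤ, z ≠ 0 → z ^ 2 ≤ 2 → z = 1 ∨ z = -1 := by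
    intro z hz hz2
    have h1 : z < 2 := by nlinarith
    have h2 : -2 < z := by nlinarith
    omega
  obtain ⟨i, -, hi⟩ : ∃ i ∈ Finset.univ, n i ^ 2 ≠ 0 :=
    Finset.exists_ne_zero_of_sum_ne_zero (by rw [h]; norm_num)
  have hsum := Finset.add_sum_erase Finset.univ (fun i => n i ^ 2) (Finset.mem_univ i)
  simp only [h] at hsum
  have hnn : 0 ≤ ∑ k ∈ Finset.univ.erase i, n k ^ 2 := Finset.sum_nonneg fun _ _ => sq_nonneg _
  have hi1 := unit (n i) (by simpa using hi) (by linarith)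
  have hi2 : n i ^ 2 = 1 := by rcases hi1 with h | h <;> simp [h]
  obtain ⟨j, hj, hj0⟩ : ∃ j ∈ Finset.univ.erase i, n j ^ 2 ≠ 0 :=
    Finset.exists_ne_zero_of_sum_ne_zero (by omega)
  have hsum' := Finset.add_sum_erase _ (fun i => n i ^ 2) hj
  have hnn' : 0 ≤ ∑ k ∈ (Finset.univ.erase i).erase j, n k ^ 2 :=
    Finset.sum_nonneg fun _ _ => sq_nonneg _
  have hj1 := unit (n j) (by simpa using hj0) (by linarith)
  have hj2 : n j ^ 2 = 1 := by rcases hj1 with h | h <;> simp [h]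
  have hz : ∑ k ∈ (Finset.univ.erase i).erase j, n k ^ 2 = 0 := by linarith
  refine ⟨i, j, (Finset.ne_of_mem_erase hj).symm, hi1, hj1, fun k hki hkj => ?_⟩
  have := (Finset.sum_eq_zero_iff_of_nonneg fun _ _ => sq_nonneg _).1 hz k (by simp [hki, hkj])
  simpa using this

/-- The roots are the vectors of squared norm two of the `E₈` lattice. -/
theorem mem_roots_iff {x : V} : x ∈ roots ↔ x ∈ lattice ∧ ⟪x, x⟫ = 2 := by
  refine ⟨fun h => ⟨mem_lattice_of_mem_roots h, inner_self_of_mem_roots h⟩, ?_⟩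
  rintro ⟨⟨a, b, m, h, hs⟩, hx⟩
  rw [inner_eq_sum] at hx
  rcases Int.even_or_odd' a with ⟨c, rfl | rfl⟩
  · left
    have hn : ∀ i, x i = ((c + m i : ℤ) : ℝ) := by
      intro i; rw [h]; push_cast; ring
    have h2 : ∑ i, (c + m i) ^ 2 = 2 := by
      simp only [hn] at hx
      have : ((∑ i, (c + m i) ^ 2 : ℤ) : ℝ) = 2 := by
        rw [← hx]; push_cast; exact Finset.sum_congr rfl fun i _ => by ring
      exact_mod_cast this
    obtain ⟨i, j, hij, hi, hj, hk⟩ := exists_of_sum_sq_eq_two h2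
    have hx' : x = (((c + m i : ℤ) : ℝ)) • e i + (((c + m j : ℤ) : ℝ)) • e j := by
      ext k
      simp only [PiLp.add_apply, PiLp.smul_apply, e_apply, smul_eq_mul, hn]
      by_cases h1 : k = i
      · subst h1; simp [hij]
      · by_cases h2 : k = j
        · subst h2; simp [h1]
        · simp [h1, h2, hk k h1 h2]
    rcases hi with hi | hi <;> rcases hj with hj | hj <;> rw [hi, hj] at hx'
    · exact ⟨i, j, hij, Or.inl (by simpa using hx')⟩
    · exact ⟨i, j, hij, Or.inr (Or.inl (by simpa [sub_eq_add_neg] using hx'))⟩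
    · exact ⟨j, i, hij.symm, Or.inr (Or.inl (by simpa [sub_eq_add_neg, add_comm] using hx'))⟩
    · exact ⟨i, j, hij, Or.inr (Or.inr (by simpa [sub_eq_add_neg] using hx'))⟩
  · right
    -- Here `x i = n + 1/2` with `n = c + m i`, so its square is `1/4 + n (n + 1)`. The eight
    -- quarters already add up to 2, which forces every `n` to be 0 or -1.
    have hn : ∀ i, x i * x i = 1 / 4 + ((c + m i) * (c + m i + 1) : ℤ) := by
      intro i; rw [h]; push_cast; ring
    have hnn : ∀ i, 0 ≤ (c + m i) * (c + m i + 1) := by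
      intro i
      rcases le_or_gt 0 (c + m i) with h | h
      · positivity
      · exact mul_nonneg_of_nonpos_of_nonpos h.le (by omega)
    have h0 : ∑ i, (c + m i) * (c + m i + 1) = 0 := by
      simp only [hn, Finset.sum_add_distrib] at hx
      have : ((∑ i, (c + m i) * (c + m i + 1) : ℤ) : ℝ) = 0 := by
        push_cast at hx ⊢
        simp at hx
        linarith
      exact_mod_cast this
    have hz : ∀ i, c + m i = 0 ∨ c + m i = -1 := by
      intro i
      have := (Finset.sum_eq_zero_iff_of_nonneg fun i _ => hnn i).1 h0 i (Finset.mem_univ i)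
      rcases mul_eq_zero.1 this with h | h <;> omega
    refine ⟨Finset.univ.filter fun i => c + m i = 0, ?_, ?_⟩
    · have hm : ∀ i, m i = (if c + m i = 0 then 1 else 0) - (c + 1) := by
        intro i; rcases hz i with h | h <;> simp [h] <;> omega
      have hs' : ∑ i, m i = (Finset.univ.filter fun i => c + m i = 0).card - 8 * (c + 1) := by
        rw [Finset.sum_congr rfl fun i _ => hm i]
        simp [Finset.sum_sub_distrib]
      rw [Nat.even_iff]
      omega
    · ext i
      rw [zeta_apply, h]
      rcases hz i with h | h
      · have : (m i : ℝ) = -c := by exact_mod_cast (by omega : m i = -c)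
        simp [h, this]; ring
      · have : (m i : ℝ) = -c - 1 := by exact_mod_cast (by omega : m i = -c - 1)
        simp [h, this]; ring

/-! ### Inner products of roots and strong orthogonality -/

theorem neg_mem_roots {x : V} (hx : x ∈ roots) : -x ∈ roots := by
  rw [mem_roots_iff] at hx ⊢
  exact ⟨neg_mem hx.1, by simpa using hx.2⟩

theorem exists_int_inner_eq_of_mem_roots {x y : V} (hx : x ∈ roots) (hy : y ∈ roots) :
    ∃ n : ℤ, ⟪x, y⟫ = n :=
  exists_int_inner_eq (mem_lattice_of_mem_roots hx) (mem_lattice_of_mem_roots hy)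

theorem sub_mem_roots {x y : V} (hx : x ∈ roots) (hy : y ∈ roots) (h : ⟪x, y⟫ = 1) :
    x - y ∈ roots := by
  rw [mem_roots_iff] at *
  refine ⟨sub_mem hx.1 hy.1, ?_⟩
  rw [real_inner_sub_sub_self, hx.2, hy.2, h]; norm_num

theorem add_mem_roots {x y : V} (hx : x ∈ roots) (hy : y ∈ roots) (h : ⟪x, y⟫ = -1) :
    x + y ∈ roots := by
  have := sub_mem_roots hx (neg_mem_roots hy) (by simp [h])
  simpa using this

theorem inner_cases {x y : V} (hx : x ∈ roots) (hy : y ∈ roots) :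
    x = y ∨ x = -y ∨ ⟪x, y⟫ = 0 ∨ ⟪x, y⟫ = 1 ∨ ⟪x, y⟫ = -1 := by
  obtain ⟨n, hn⟩ := exists_int_inner_eq_of_mem_roots hx hy
  have h1 := real_inner_sub_sub_self x y
  have h2 := real_inner_add_add_self x y
  rw [inner_self_of_mem_roots hx, inner_self_of_mem_roots hy, hn] at h1 h2
  have p1 : 0 ≤ ⟪x - y, x - y⟫ := real_inner_self_nonneg
  have p2 : 0 ≤ ⟪x + y, x + y⟫ := real_inner_self_nonneg
  have b1 : n ≤ 2 := by exact_mod_cast (by linarith : (n : ℝ) ≤ 2)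
  have b2 : -2 ≤ n := by exact_mod_cast (by linarith : (-2 : ℝ) ≤ n)
  rw [hn]
  interval_cases n
  · right; left
    rw [eq_neg_iff_add_eq_zero, ← inner_self_eq_zero (𝕜 := ℝ), h2]; norm_num
  · right; right; right; right; norm_num
  · right; right; left; norm_num
  · right; right; right; left; norm_num
  · left
    rw [← sub_eq_zero, ← inner_self_eq_zero (𝕜 := ℝ), h1]; norm_num

/-- Strong orthogonality of roots of `E₈` is orthogonality. -/
theorem stronglyOrthogonal_iff {x y : V} (hx : x ∈ roots) (hy : y ∈ roots) :
    StronglyOrthogonal x y ↔ ⟪x, y⟫ = 0 := by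
  constructor
  · rintro ⟨h1, h2, h3, h4⟩
    rcases inner_cases hx hy with h | h | h | h | h
    · exact absurd h h1
    · exact absurd h h2
    · exact h
    · exact absurd (sub_mem_roots hx hy h) h4
    · exact absurd (add_mem_roots hx hy h) h3
  · intro h
    have hyy := inner_self_of_mem_roots hy
    refine ⟨?_, ?_, fun hr => ?_, fun hr => ?_⟩
    · rintro rfl; rw [h] at hyy; norm_num at hyy
    · rintro rfl; rw [inner_neg_left] at h; linarith
    · have := inner_self_of_mem_roots hr
      rw [real_inner_add_add_self, inner_self_of_mem_roots hx, hyy, h] at this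
      norm_num at this
    · have := inner_self_of_mem_roots hr
      rw [real_inner_sub_sub_self, inner_self_of_mem_roots hx, hyy, h] at this
      norm_num at this

/-! ### The Weyl group and conjugation of roots -/

theorem refl_apply_of_mem_roots {v : V} (hv : v ∈ roots) (x : V) :
    refl v x = x - ⟪x, v⟫ • v := by
  rw [refl_apply, inner_self_of_mem_roots hv, mul_div_assoc, mul_div_left_comm]; norm_num

theorem isometry_mul_apply (w w' : V ≃ₗᵢ[ℝ] V) (x : V) : (w * w') x = w (w' x) := rfl

theorem refl_mem_weylGroup {v : V} (hv : v ∈ roots) : refl v ∈ weylGroup :=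
  Subgroup.subset_closure ⟨v, hv, rfl⟩

theorem refl_self (v : V) (hv : v ∈ roots) : refl v v = -v := by
  rw [refl_apply_of_mem_roots hv, inner_self_of_mem_roots hv, two_smul]; abel

theorem refl_apply_of_inner_eq_zero {v x : V} (h : ⟪x, v⟫ = 0) : refl v x = x := by
  rw [refl_apply, h]; simp

theorem refl_mem_roots {v x : V} (hv : v ∈ roots) (hx : x ∈ roots) : refl v x ∈ roots := by
  obtain ⟨n, hn⟩ := exists_int_inner_eq_of_mem_roots hx hv
  refine mem_roots_iff.2 ⟨?_, ?_⟩
  · rw [refl_apply_of_mem_roots hv, hn, Int.cast_smul_eq_zsmul]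
    exact sub_mem (mem_lattice_of_mem_roots hx) (zsmul_mem (mem_lattice_of_mem_roots hv) n)
  · rw [LinearIsometryEquiv.inner_map_map, inner_self_of_mem_roots hx]

/-- The Weyl group preserves the roots. -/
theorem weyl_mem_roots {w : V ≃ₗᵢ[ℝ] V} (hw : w ∈ weylGroup) : ∀ x ∈ roots, w x ∈ roots := by
  induction hw using Subgroup.closure_induction'' with
  | one => exact fun x hx => hx
  | mem w hw =>
    obtain ⟨v, hv, rfl⟩ := hw
    exact fun x hx => refl_mem_roots hv hx
  | inv_mem w hw =>
    obtain ⟨v, hv, rfl⟩ := hw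
    have : (refl v)⁻¹ = refl v := Submodule.reflection_inv
    rw [this]
    exact fun x hx => refl_mem_roots hv hx
  | mul w w' _ _ h h' => exact fun x hx => h _ (h' x hx)

theorem weyl_mem_roots_iff {w : V ≃ₗᵢ[ℝ] V} (hw : w ∈ weylGroup) {x : V} :
    w x ∈ roots ↔ x ∈ roots := by
  refine ⟨fun h => ?_, weyl_mem_roots hw x⟩
  have := weyl_mem_roots (inv_mem hw) _ h
  rwa [← isometry_mul_apply, inv_mul_cancel] at this

/-- A root that is not orthogonal to the root `g` can be moved to `g` by an element of the Weyl
group which fixes all vectors orthogonal to both. -/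
theorem exists_weyl_apply_eq_of_inner_ne_zero {P : Set V} {x g : V} (hx : x ∈ roots)
    (hg : g ∈ roots) (hxP : ∀ p ∈ P, ⟪p, x⟫ = 0) (hgP : ∀ p ∈ P, ⟪p, g⟫ = 0)
    (h : ⟪x, g⟫ ≠ 0) : ∃ w ∈ weylGroup, (∀ p ∈ P, w p = p) ∧ w x = g := by
  have hxx := inner_self_of_mem_roots hx
  rcases inner_cases hx hg with rfl | rfl | h0 | h1 | h1
  · exact ⟨1, one_mem _, fun _ _ => rfl, rfl⟩
  · exact ⟨refl g, refl_mem_weylGroup hg, fun p hp => refl_apply_of_inner_eq_zero (hgP p hp),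
      by rw [map_neg, refl_self g hg, neg_neg]⟩
  · exact absurd h0 h
  -- For inner product 1, `x - g` is a root whose reflection exchanges `x` and `g`; for -1, the
  -- reflection in `x + g` sends `x` to `-g`, which `refl g` then corrects.
  · have hr := sub_mem_roots hx hg h1
    refine ⟨refl (x - g), refl_mem_weylGroup hr, fun p hp => refl_apply_of_inner_eq_zero ?_, ?_⟩
    · rw [inner_sub_right, hxP p hp, hgP p hp, sub_zero]
    · rw [refl_apply_of_mem_roots hr, inner_sub_right, hxx, h1]
      norm_num
  · have hr := add_mem_roots hx hg h1
    refine ⟨refl g * refl (x + g), mul_mem (refl_mem_weylGroup hg) (refl_mem_weylGroup hr),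
      fun p hp => ?_, ?_⟩
    · rw [isometry_mul_apply, refl_apply_of_inner_eq_zero (v := x + g),
        refl_apply_of_inner_eq_zero (hgP p hp)]
      rw [inner_add_right, hxP p hp, hgP p hp, add_zero]
    · have : refl (x + g) x = -g := by
        rw [refl_apply_of_mem_roots hr, inner_add_right, hxx, h1]
        norm_num
      rw [isometry_mul_apply, this, map_neg, refl_self g hg, neg_neg]

/-- Passing through the intermediate root `g` covers the case where `x` and `y` are orthogonal to
each other. -/
theorem exists_weyl_apply_eq {P : Set V} {x y g : V} (hx : x ∈ roots) (hy : y ∈ roots)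
    (hg : g ∈ roots) (hxP : ∀ p ∈ P, ⟪p, x⟫ = 0) (hyP : ∀ p ∈ P, ⟪p, y⟫ = 0)
    (hgP : ∀ p ∈ P, ⟪p, g⟫ = 0) (hxg : ⟪g, x⟫ ≠ 0) (hyg : ⟪g, y⟫ ≠ 0) :
    ∃ w ∈ weylGroup, (∀ p ∈ P, w p = p) ∧ w x = y := by
  obtain ⟨w, hw, hwP, hwx⟩ := exists_weyl_apply_eq_of_inner_ne_zero hx hg hxP hgP
    (by rwa [real_inner_comm])
  obtain ⟨w', hw', hwP', hwx'⟩ := exists_weyl_apply_eq_of_inner_ne_zero hg hy hgP hyP hyg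
  exact ⟨w' * w, mul_mem hw' hw, fun p hp => by
    rw [isometry_mul_apply, hwP p hp, hwP' p hp], by
    rw [isometry_mul_apply, hwx, hwx']⟩

/-! ### The frame and orbits of orthogonal tuples -/

/-- A maximal system of orthogonal roots. -/
noncomputable def frame : Fin 8 → V :=
  ![e 0 + e 1, e 0 - e 1, e 2 + e 3, e 2 - e 3, e 4 + e 5, e 4 - e 5, e 6 + e 7, e 6 - e 7]

theorem frame_mem_roots (i : Fin 8) : frame i ∈ roots := by
  fin_cases i <;> first
    | exact e_add_e_mem_roots (by decide)
    | exact e_sub_e_mem_roots (by decide)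

theorem inner_e_add_e (x : V) (i j : Fin 8) : ⟪e i + e j, x⟫ = x i + x j := by
  rw [inner_add_left, inner_e, inner_e]

theorem inner_e_sub_e (x : V) (i j : Fin 8) : ⟪e i - e j, x⟫ = x i - x j := by
  rw [inner_sub_left, inner_e, inner_e]

theorem inner_zeta (x : V) (I : Finset (Fin 8)) :
    ⟪zeta I, x⟫ = ∑ i, if i ∈ I then x i / 2 else -(x i / 2) := by
  rw [inner_eq_sum]
  refine Finset.sum_congr rfl fun i _ => ?_
  rw [zeta_apply]
  split_ifs <;> ring

theorem inner_frame_frame (i j : Fin 8) : ⟪frame i, frame j⟫ = if i = j then 2 else 0 := by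
  fin_cases i <;> fin_cases j <;>
    simp only [frame, Fin.reduceFinMk, Fin.isValue, Matrix.cons_val, inner_e_add_e, inner_e_sub_e,
      PiLp.add_apply, PiLp.sub_apply, e_apply] <;> norm_num [Fin.ext_iff]

theorem frame_injective : Function.Injective frame := by
  intro i j h
  by_contra hij
  have := inner_frame_frame i j
  rw [h, inner_frame_frame] at this
  simp [hij] at this

theorem inner_self_eq_coords (x : V) : ⟪x, x⟫ = x 0 ^ 2 + x 1 ^ 2 + x 2 ^ 2 + x 3 ^ 2 + x 4 ^ 2 +
    x 5 ^ 2 + x 6 ^ 2 + x 7 ^ 2 := by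
  rw [inner_eq_sum, Fin.sum_univ_eight]; ring

/-- The roots not orthogonal to `frame 0` span the space, so a nonzero `x` cannot be orthogonal to
all of them; one that is not orthogonal to `x` serves as the link. The next two lemmas repeat this
argument inside E₇ and D₆. -/
theorem exists_weyl_frame_zero {x : V} (hx : x ∈ roots) : ∃ w ∈ weylGroup, w x = frame 0 := by
  suffices ∃ g ∈ roots, ⟪g, x⟫ ≠ 0 ∧ ⟪g, frame 0⟫ ≠ 0 by
    obtain ⟨g, hg, hgx, hgf⟩ := this
    obtain ⟨w, hw, -, h⟩ := exists_weyl_apply_eq (P := ∅) hx (frame_mem_roots 0) hg (by simp)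
      (by simp) (by simp) hgx hgf
    exact ⟨w, hw, h⟩
  by_contra! hc
  have key : ∀ g ∈ roots, ⟪g, frame 0⟫ ≠ 0 → ⟪g, x⟫ = 0 := fun g hg h => by
    by_contra h'; exact h (hc g hg h')
  have h1 : ∀ j : Fin 8, j ≠ 0 → j ≠ 1 → x 0 + x j = 0 := fun j h0 h1 => by
    rw [← inner_e_add_e]
    refine key _ (e_add_e_mem_roots h0.symm) ?_
    simp [frame, inner_e_add_e, e_apply, h0, h1]
  have h2 : ∀ j : Fin 8, j ≠ 0 → j ≠ 1 → x 0 - x j = 0 := fun j h0 h1 => by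
    rw [← inner_e_sub_e]
    refine key _ (e_sub_e_mem_roots h0.symm) ?_
    simp [frame, inner_e_sub_e, e_apply, h0, h1]
  have h3 : x 1 + x 2 = 0 := by
    rw [← inner_e_add_e]
    refine key _ (e_add_e_mem_roots (by decide)) ?_
    simp [frame, inner_e_add_e, e_apply]
  have hz : ∀ j : Fin 8, j ≠ 0 → j ≠ 1 → x j = 0 := fun j h0 h1' => by
    linarith [h1 j h0 h1', h2 j h0 h1']
  have h0 : x 0 = 0 := by linarith [h1 2 (by decide) (by decide), h2 2 (by decide) (by decide)]
  have hxx := inner_self_of_mem_roots hx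
  rw [inner_self_eq_coords, h0, hz 3 (by decide) (by decide), hz 4 (by decide) (by decide),
    hz 5 (by decide) (by decide), hz 6 (by decide) (by decide), hz 7 (by decide) (by decide),
    hz 2 (by decide) (by decide),
    show x 1 = 0 by linarith [hz 2 (by decide) (by decide)]] at hxx
  norm_num at hxx

theorem exists_weyl_frame_one {x : V} (hx : x ∈ roots) (h0 : ⟪frame 0, x⟫ = 0) :
    ∃ w ∈ weylGroup, w (frame 0) = frame 0 ∧ w x = frame 1 := by
  suffices ∃ g ∈ roots, ⟪frame 0, g⟫ = 0 ∧ ⟪g, x⟫ ≠ 0 ∧ ⟪g, frame 1⟫ ≠ 0 by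
    obtain ⟨g, hg, h0g, hgx, hgf⟩ := this
    obtain ⟨w, hw, hP, h⟩ := exists_weyl_apply_eq (P := {frame 0}) hx (frame_mem_roots 1) hg
      (by simpa using h0) (by simp [inner_frame_frame]) (by simpa using h0g) hgx hgf
    exact ⟨w, hw, hP _ rfl, h⟩
  by_contra! hc
  have key : ∀ g ∈ roots, ⟪frame 0, g⟫ = 0 → ⟪g, frame 1⟫ ≠ 0 → ⟪g, x⟫ = 0 := fun g hg h h' => by
    by_contra h''; exact h' (hc g hg h h'')
  have hz : ∀ I : Finset (Fin 8), Even I.card → 0 ∈ I → 1 ∉ I → ⟪zeta I, x⟫ = 0 := by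
    intro I hI h0 h1
    refine key _ (zeta_mem_roots hI) ?_ ?_
    · simp [frame, inner_e_add_e, zeta_apply, h0, h1]
    · rw [real_inner_comm]
      simp [frame, inner_e_sub_e, zeta_apply, h0, h1]
  -- Together with `h0`, these eight linear equations force `x = 0`.
  have a1 := hz {0, 3, 4, 5, 6, 7} (by decide) (by decide) (by decide)
  have a2 := hz {0, 2, 4, 5, 6, 7} (by decide) (by decide) (by decide)
  have a3 := hz {0, 2, 3, 5, 6, 7} (by decide) (by decide) (by decide)
  have a4 := hz {0, 2, 3, 4, 6, 7} (by decide) (by decide) (by decide)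
  have a5 := hz {0, 2, 3, 4, 5, 7} (by decide) (by decide) (by decide)
  have a6 := hz {0, 2, 3, 4, 5, 6} (by decide) (by decide) (by decide)
  have a7 := hz {0, 2, 3, 4} (by decide) (by decide) (by decide)
  have a8 := hz {0, 5, 6, 7} (by decide) (by decide) (by decide)
  simp [inner_zeta, Fin.sum_univ_eight] at a1 a2 a3 a4 a5 a6 a7 a8
  simp only [frame, Matrix.cons_val, inner_e_add_e] at h0
  have hxx := inner_self_of_mem_roots hx
  rw [inner_self_eq_coords, show x 0 = 0 by linarith, show x 1 = 0 by linarith,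
    show x 2 = 0 by linarith, show x 3 = 0 by linarith, show x 4 = 0 by linarith,
    show x 5 = 0 by linarith, show x 6 = 0 by linarith, show x 7 = 0 by linarith] at hxx
  norm_num at hxx

theorem exists_weyl_frame_two {x : V} (hx : x ∈ roots) (h0 : ⟪frame 0, x⟫ = 0)
    (h1 : ⟪frame 1, x⟫ = 0) :
    ∃ w ∈ weylGroup, w (frame 0) = frame 0 ∧ w (frame 1) = frame 1 ∧ w x = frame 2 := by
  suffices ∃ g ∈ roots, (⟪frame 0, g⟫ = 0 ∧ ⟪frame 1, g⟫ = 0) ∧ ⟪g, x⟫ ≠ 0 ∧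
      ⟪g, frame 2⟫ ≠ 0 by
    obtain ⟨g, hg, hPg, hgx, hgf⟩ := this
    obtain ⟨w, hw, hP, h⟩ := exists_weyl_apply_eq (P := {frame 0, frame 1}) hx
      (frame_mem_roots 2) hg (by simp [h0, h1]) (by simp [inner_frame_frame]) (by simp [hPg])
      hgx hgf
    exact ⟨w, hw, hP _ (by simp), hP _ (by simp), h⟩
  by_contra! hc
  have key : ∀ g ∈ roots, (⟪frame 0, g⟫ = 0 ∧ ⟪frame 1, g⟫ = 0) → ⟪g, frame 2⟫ ≠ 0 →
      ⟪g, x⟫ = 0 := fun g hg h h' => by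
    by_contra h''; exact h' (hc g hg h h'')
  simp only [frame, Matrix.cons_val, inner_e_add_e, inner_e_sub_e] at h0 h1 key
  have a1 : ∀ j : Fin 8, j ≠ 0 → j ≠ 1 → j ≠ 2 → j ≠ 3 → x 2 + x j = 0 := by
    intro j n0 n1 n2 n3
    rw [← inner_e_add_e]
    refine key _ (e_add_e_mem_roots n2.symm) ?_ ?_ <;>
      simp [inner_e_add_e, e_apply, n0.symm, n1.symm, n2, n3]
  have a2 : ∀ j : Fin 8, j ≠ 0 → j ≠ 1 → j ≠ 2 → j ≠ 3 → x 2 - x j = 0 := by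
    intro j n0 n1 n2 n3
    rw [← inner_e_sub_e]
    refine key _ (e_sub_e_mem_roots n2.symm) ?_ ?_ <;>
      simp [inner_e_sub_e, e_apply, n0.symm, n1.symm, n2, n3]
  have a3 : x 3 + x 4 = 0 := by
    rw [← inner_e_add_e]
    refine key _ (e_add_e_mem_roots (by decide)) ?_ ?_ <;> simp [inner_e_add_e, e_apply]
  have b4 := a1 4 (by decide) (by decide) (by decide) (by decide)
  have c4 := a2 4 (by decide) (by decide) (by decide) (by decide)
  have b5 := a1 5 (by decide) (by decide) (by decide) (by decide)
  have b6 := a1 6 (by decide) (by decide) (by decide) (by decide)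
  have b7 := a1 7 (by decide) (by decide) (by decide) (by decide)
  have hxx := inner_self_of_mem_roots hx
  rw [inner_self_eq_coords, show x 0 = 0 by linarith, show x 1 = 0 by linarith,
    show x 2 = 0 by linarith, show x 3 = 0 by linarith, show x 4 = 0 by linarith,
    show x 5 = 0 by linarith, show x 6 = 0 by linarith, show x 7 = 0 by linarith] at hxx
  norm_num at hxx

/-- The roots orthogonal to the first three frame vectors form A₁ + D₄, with A₁ consisting of `±
frame 3` and D₄ living on the last four coordinates. A root with no link to `frame 4` vanishes on
those coordinates, hence lies in A₁. -/
theorem eq_or_eq_neg_frame_three_or_exists_weyl_frame_four {x : V} (hx : x ∈ roots)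
    (h0 : ⟪frame 0, x⟫ = 0) (h1 : ⟪frame 1, x⟫ = 0) (h2 : ⟪frame 2, x⟫ = 0) :
    x = frame 3 ∨ x = -frame 3 ∨ ∃ w ∈ weylGroup, w (frame 0) = frame 0 ∧
      w (frame 1) = frame 1 ∧ w (frame 2) = frame 2 ∧ w x = frame 4 := by
  by_cases hg : ∃ g ∈ roots, (⟪frame 0, g⟫ = 0 ∧ ⟪frame 1, g⟫ = 0 ∧ ⟪frame 2, g⟫ = 0) ∧
      ⟪g, x⟫ ≠ 0 ∧ ⟪g, frame 4⟫ ≠ 0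
  · obtain ⟨g, hg, hPg, hgx, hgf⟩ := hg
    obtain ⟨w, hw, hP, h⟩ := exists_weyl_apply_eq (P := {frame 0, frame 1, frame 2}) hx
      (frame_mem_roots 4) hg (by simp [h0, h1, h2]) (by simp [inner_frame_frame])
      (by simp [hPg]) hgx hgf
    exact Or.inr (Or.inr ⟨w, hw, hP _ (by simp), hP _ (by simp), hP _ (by simp), h⟩)
  push Not at hg
  have key : ∀ g ∈ roots, (⟪frame 0, g⟫ = 0 ∧ ⟪frame 1, g⟫ = 0 ∧ ⟪frame 2, g⟫ = 0) →
      ⟪g, frame 4⟫ ≠ 0 → ⟪g, x⟫ = 0 := fun g h h' h'' => by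
    by_contra h3; exact h'' (hg g h h' h3)
  simp only [frame, Matrix.cons_val, inner_e_add_e, inner_e_sub_e] at h0 h1 h2 key
  have a1 : x 4 + x 6 = 0 := by
    rw [← inner_e_add_e]
    refine key _ (e_add_e_mem_roots (by decide)) ?_ ?_ <;> simp [inner_e_add_e, e_apply]
  have a2 : x 4 - x 6 = 0 := by
    rw [← inner_e_sub_e]
    refine key _ (e_sub_e_mem_roots (by decide)) ?_ ?_ <;> simp [inner_e_sub_e, e_apply]
  have a3 : x 4 + x 7 = 0 := by
    rw [← inner_e_add_e]
    refine key _ (e_add_e_mem_roots (by decide)) ?_ ?_ <;> simp [inner_e_add_e, e_apply]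
  have a4 : x 5 + x 6 = 0 := by
    rw [← inner_e_add_e]
    refine key _ (e_add_e_mem_roots (by decide)) ?_ ?_ <;> simp [inner_e_add_e, e_apply]
  have z0 : x 0 = 0 := by linarith
  have z1 : x 1 = 0 := by linarith
  have z3 : x 3 = -x 2 := by linarith
  have z4 : x 4 = 0 := by linarith
  have z5 : x 5 = 0 := by linarith
  have z6 : x 6 = 0 := by linarith
  have z7 : x 7 = 0 := by linarith
  have hxx := inner_self_of_mem_roots hx
  rw [inner_self_eq_coords, z0, z1, z3, z4, z5, z6, z7] at hxx
  have hc : x 2 = 1 ∨ x 2 = -1 := by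
    have : (x 2 - 1) * (x 2 + 1) = 0 := by linarith
    rcases mul_eq_zero.1 this with h | h
    · left; linarith
    · right; linarith
  rcases hc with hc | hc
  · left; ext i
    fin_cases i <;> simp [frame, e_apply, z0, z1, z3, z4, z5, z6, z7, hc]
  · right; left; ext i
    fin_cases i <;> simp [frame, e_apply, z0, z1, z3, z4, z5, z6, z7, hc]

/-- The roots orthogonal to four roots of the frame which do not lie in a subsystem of type `D₄`
are, up to sign, the other roots of the frame. -/
theorem exists_eq_frame_of_inner_eq_zero {x : V} (hx : x ∈ roots) (h0 : ⟪frame 0, x⟫ = 0)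
    (h1 : ⟪frame 1, x⟫ = 0) (h2 : ⟪frame 2, x⟫ = 0) (h4 : ⟪frame 4, x⟫ = 0) :
    ∃ i, x = frame i ∨ x = -frame i := by
  simp only [frame, Matrix.cons_val, inner_e_add_e, inner_e_sub_e] at h0 h1 h2 h4
  have z0 : x 0 = 0 := by linarith
  have z1 : x 1 = 0 := by linarith
  have z3 : x 3 = -x 2 := by linarith
  have z5 : x 5 = -x 4 := by linarith
  -- Since `x 0 = 0`, pairing with `e 0 + e i` shows that all coordinates are integers: no `ζ_I` can
  -- occur.
  have int : ∀ i : Fin 8, i ≠ 0 → ∃ n : ℤ, x i = n := fun i hi => by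
    obtain ⟨n, hn⟩ := exists_int_inner_eq_of_mem_roots (e_add_e_mem_roots hi) hx
    rw [inner_e_add_e, z0, add_zero] at hn
    exact ⟨n, hn⟩
  obtain ⟨a, ha⟩ := int 2 (by decide)
  obtain ⟨b, hb⟩ := int 4 (by decide)
  obtain ⟨c, hc⟩ := int 6 (by decide)
  obtain ⟨d, hd⟩ := int 7 (by decide)
  rw [ha] at z3
  rw [hb] at z5
  have hxx := inner_self_of_mem_roots hx
  rw [inner_self_eq_coords, z0, z1, ha, z3, hb, z5, hc, hd] at hxx
  have hs : 2 * a ^ 2 + 2 * b ^ 2 + c ^ 2 + d ^ 2 = 2 := by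
    have : ((2 * a ^ 2 + 2 * b ^ 2 + c ^ 2 + d ^ 2 : ℤ) : ℝ) = 2 := by
      push_cast; linarith
    exact_mod_cast this
  have a1 : a ≤ 1 := by nlinarith
  have a2 : -1 ≤ a := by nlinarith
  have b1 : b ≤ 1 := by nlinarith
  have b2 : -1 ≤ b := by nlinarith
  have c1 : c ≤ 1 := by nlinarith
  have c2 : -1 ≤ c := by nlinarith
  have d1 : d ≤ 1 := by nlinarith
  have d2 : -1 ≤ d := by nlinarith
  have hcases : (a = 1 ∨ a = -1) ∧ b = 0 ∧ c = 0 ∧ d = 0 ∨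
      (b = 1 ∨ b = -1) ∧ a = 0 ∧ c = 0 ∧ d = 0 ∨
      (c = 1 ∧ d = 1 ∨ c = -1 ∧ d = -1 ∨ c = 1 ∧ d = -1 ∨ c = -1 ∧ d = 1) ∧ a = 0 ∧ b = 0 := by
    interval_cases a <;> interval_cases b <;> interval_cases c <;> interval_cases d <;>
      simp at hs ⊢
  have ext_coords : ∀ y : V, 0 = y 0 → 0 = y 1 → a = y 2 → -a = y 3 → b = y 4 → -b = y 5 →
      c = y 6 → d = y 7 → x = y := by
    intro y _ _ _ _ _ _ _ _
    ext i
    fin_cases i <;> simp only [Fin.reduceFinMk, Fin.isValue, Fin.zero_eta, Fin.mk_one] <;> linarith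
  rcases hcases with ⟨rfl | rfl, rfl, rfl, rfl⟩ | ⟨rfl | rfl, rfl, rfl, rfl⟩ |
    ⟨⟨rfl, rfl⟩ | ⟨rfl, rfl⟩ | ⟨rfl, rfl⟩ | ⟨rfl, rfl⟩, rfl, rfl⟩
  · exact ⟨3, Or.inl <| by apply ext_coords <;> simp [frame, e_apply]⟩
  · exact ⟨3, Or.inr <| by apply ext_coords <;> simp [frame, e_apply]⟩
  · exact ⟨5, Or.inl <| by apply ext_coords <;> simp [frame, e_apply]⟩
  · exact ⟨5, Or.inr <| by apply ext_coords <;> simp [frame, e_apply]⟩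
  · exact ⟨6, Or.inl <| by apply ext_coords <;> simp [frame, e_apply]⟩
  · exact ⟨6, Or.inr <| by apply ext_coords <;> simp [frame, e_apply]⟩
  · exact ⟨7, Or.inl <| by apply ext_coords <;> simp [frame, e_apply]⟩
  · exact ⟨7, Or.inr <| by apply ext_coords <;> simp [frame, e_apply]⟩

/-- The Weyl group is transitive on ordered triples of orthogonal roots. -/
theorem exists_weyl_triple {x y z : V} (hx : x ∈ roots) (hy : y ∈ roots) (hz : z ∈ roots)
    (hxy : ⟪x, y⟫ = 0) (hxz : ⟪x, z⟫ = 0) (hyz : ⟪y, z⟫ = 0) :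
    ∃ w ∈ weylGroup, w x = frame 0 ∧ w y = frame 1 ∧ w z = frame 2 := by
  obtain ⟨w₀, hw₀, h₀⟩ := exists_weyl_frame_zero hx
  obtain ⟨w₁, hw₁, h₁₀, h₁⟩ := exists_weyl_frame_one (weyl_mem_roots hw₀ y hy)
    (by rw [← h₀, LinearIsometryEquiv.inner_map_map, hxy])
  obtain ⟨w₂, hw₂, h₂₀, h₂₁, h₂⟩ := exists_weyl_frame_two
    (weyl_mem_roots hw₁ _ (weyl_mem_roots hw₀ z hz))
    (by rw [← h₁₀, ← h₀, LinearIsometryEquiv.inner_map_map, LinearIsometryEquiv.inner_map_map, hxz])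
    (by rw [← h₁, LinearIsometryEquiv.inner_map_map, LinearIsometryEquiv.inner_map_map, hyz])
  refine ⟨w₂ * (w₁ * w₀), mul_mem hw₂ (mul_mem hw₁ hw₀), ?_, ?_, ?_⟩ <;>
    simp only [isometry_mul_apply, h₀, h₁, h₂, h₁₀, h₂₀, h₂₁]

/-- The Weyl group has at most two orbits on ordered quadruples of orthogonal roots. -/
theorem exists_weyl_quadruple {α : Fin 4 → V} (hα : ∀ i, α i ∈ roots)
    (ho : Pairwise fun i j => ⟪α i, α j⟫ = 0) :
    ∃ w ∈ weylGroup, w (α 0) = frame 0 ∧ w (α 1) = frame 1 ∧ w (α 2) = frame 2 ∧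
      (w (α 3) = frame 3 ∨ w (α 3) = frame 4) := by
  obtain ⟨w, hw, h0, h1, h2⟩ := exists_weyl_triple (hα 0) (hα 1) (hα 2) (ho (by decide))
    (ho (by decide)) (ho (by decide))
  have ho' : ∀ i, i ≠ 3 → ⟪w (α i), w (α 3)⟫ = 0 := fun i hi => by
    rw [LinearIsometryEquiv.inner_map_map, ho hi]
  rcases eq_or_eq_neg_frame_three_or_exists_weyl_frame_four (weyl_mem_roots hw _ (hα 3))
    (by rw [← h0, ho' 0 (by decide)]) (by rw [← h1, ho' 1 (by decide)])
    (by rw [← h2, ho' 2 (by decide)]) with h | h | ⟨w', hw', h0', h1', h2', h3'⟩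
  · exact ⟨w, hw, h0, h1, h2, Or.inl h⟩
  · refine ⟨refl (frame 3) * w, mul_mem (refl_mem_weylGroup (frame_mem_roots 3)) hw, ?_, ?_, ?_,
      Or.inl ?_⟩
    · rw [isometry_mul_apply, h0, refl_apply_of_inner_eq_zero (by simp [inner_frame_frame])]
    · rw [isometry_mul_apply, h1, refl_apply_of_inner_eq_zero (by simp [inner_frame_frame])]
    · rw [isometry_mul_apply, h2, refl_apply_of_inner_eq_zero (by simp [inner_frame_frame])]
    · rw [isometry_mul_apply, h, map_neg, refl_self _ (frame_mem_roots 3), neg_neg]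
  · exact ⟨w' * w, mul_mem hw' hw, by rw [isometry_mul_apply, h0, h0'],
      by rw [isometry_mul_apply, h1, h1'], by rw [isometry_mul_apply, h2, h2'],
      Or.inr (by rw [isometry_mul_apply, h3'])⟩

/-! ### Klein four-groups and half sums -/

/-- Both sides are -1 on the plane spanned by `u` and `v` and the identity on its complement: the
vectors `(u ± v) / 2` are another orthogonal basis of that plane. -/
theorem refl_mul_refl_eq {u v : V} (hu : ⟪u, u⟫ = 4) (hv : ⟪v, v⟫ = 4) (huv : ⟪u, v⟫ = 0) :
    refl u * refl v =
      refl ((1 / 2 : ℝ) • (u + v)) * refl ((1 / 2 : ℝ) • (u - v)) := by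
  have hvu : ⟪v, u⟫ = 0 := by rw [real_inner_comm, huv]
  ext1 x
  simp only [isometry_mul_apply, refl_apply, inner_sub_left, inner_smul_left, inner_smul_right,
    inner_add_left, inner_add_right, inner_sub_right, hu, hv, huv, hvu, RCLike.conj_to_real]
  norm_num
  module

/-- If half the sum of four orthogonal roots is a root, then the double transpositions of these
roots are in the Weyl group. -/
theorem refl_mul_refl_mem_weylGroup {a b c d : V} (ha : a ∈ roots) (hb : b ∈ roots)
    (hc : c ∈ roots) (hd : d ∈ roots) (hab : ⟪a, b⟫ = 0) (hac : ⟪a, c⟫ = 0) (had : ⟪a, d⟫ = 0)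
    (hbc : ⟪b, c⟫ = 0) (hbd : ⟪b, d⟫ = 0) (hcd : ⟪c, d⟫ = 0)
    (h : (1 / 2 : ℝ) • (a + b + c + d) ∈ roots) :
    refl (a - b) * refl (c - d) ∈ weylGroup := by
  have haa := inner_self_of_mem_roots ha
  have hbb := inner_self_of_mem_roots hb
  have hcc := inner_self_of_mem_roots hc
  have hdd := inner_self_of_mem_roots hd
  have hba : ⟪b, a⟫ = 0 := by rw [real_inner_comm, hab]
  have hca : ⟪c, a⟫ = 0 := by rw [real_inner_comm, hac]
  have hda : ⟪d, a⟫ = 0 := by rw [real_inner_comm, had]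
  have hcb : ⟪c, b⟫ = 0 := by rw [real_inner_comm, hbc]
  have hdb : ⟪d, b⟫ = 0 := by rw [real_inner_comm, hbd]
  have hdc : ⟪d, c⟫ = 0 := by rw [real_inner_comm, hcd]
  -- With `h` the half sum, `u = a - b` and `v = c - d`, one has `(u + v) / 2 = h - b - d` and `(u -
  -- v) / 2 = h - b - c`; each subtraction is of a root with inner product 1.
  have h₁ := sub_mem_roots h hb (by
    simp only [inner_smul_left, inner_add_left, hab, hbb, hcb, hdb, RCLike.conj_to_real]; norm_num)
  have h₂ := sub_mem_roots h₁ hd (by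
    simp only [inner_sub_left, inner_smul_left, inner_add_left, had, hbd, hcd, hdd,
      RCLike.conj_to_real]; norm_num)
  have h₃ := sub_mem_roots h₁ hc (by
    simp only [inner_sub_left, inner_smul_left, inner_add_left, hac, hbc, hcc, hdc,
      RCLike.conj_to_real]; norm_num)
  rw [refl_mul_refl_eq]
  · refine mul_mem (refl_mem_weylGroup ?_) (refl_mem_weylGroup ?_)
    · convert h₂ using 1; module
    · convert h₃ using 1; module
  · rw [real_inner_sub_sub_self, haa, hbb, hab]; norm_num
  · rw [real_inner_sub_sub_self, hcc, hdd, hcd]; norm_num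
  · simp only [inner_sub_left, inner_sub_right, hac, had, hbc, hbd]; norm_num

theorem refl_map (w : V ≃ₗᵢ[ℝ] V) (v : V) : refl (w v) = w * refl v * w⁻¹ := by
  ext1 x
  have hx : x = w (w⁻¹ x) := by rw [← isometry_mul_apply, mul_inv_cancel]; rfl
  rw [isometry_mul_apply, isometry_mul_apply, refl_apply, refl_apply, map_sub, map_smul, ← hx]
  conv_lhs => rw [hx]
  rw [LinearIsometryEquiv.inner_map_map, LinearIsometryEquiv.inner_map_map, ← hx]

theorem klein_subset_iff (v : Fin 4 → V) :
    klein v ⊆ (weylGroup : Set (V ≃ₗᵢ[ℝ] V)) ↔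
      refl (v 0 - v 1) * refl (v 2 - v 3) ∈ weylGroup ∧
      refl (v 0 - v 2) * refl (v 1 - v 3) ∈ weylGroup ∧
      refl (v 0 - v 3) * refl (v 1 - v 2) ∈ weylGroup := by
  simp [klein, Set.insert_subset_iff, one_mem]

theorem klein_map_subset_iff {w : V ≃ₗᵢ[ℝ] V} (hw : w ∈ weylGroup) (v : Fin 4 → V) :
    klein (fun i => w (v i)) ⊆ (weylGroup : Set (V ≃ₗᵢ[ℝ] V)) ↔
      klein v ⊆ (weylGroup : Set (V ≃ₗᵢ[ℝ] V)) := by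
  have key : ∀ a b : V, refl (w a) * refl (w b) ∈ weylGroup ↔ refl a * refl b ∈ weylGroup := by
    intro a b
    rw [refl_map, refl_map, show w * refl a * w⁻¹ * (w * refl b * w⁻¹) =
      w * (refl a * refl b) * w⁻¹ by group, Subgroup.mul_mem_cancel_right _ (inv_mem hw),
      Subgroup.mul_mem_cancel_left _ hw]
  simp only [klein_subset_iff, ← map_sub, key]

theorem isStronglyOrthogonalQuadruple_iff {α : Fin 4 → V} : IsStronglyOrthogonalQuadruple α ↔
    (∀ i, α i ∈ roots) ∧ Pairwise fun i j => ⟪α i, α j⟫ = 0 :=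
  and_congr_right fun h => forall₃_congr fun i j _ => stronglyOrthogonal_iff (h i) (h j)

theorem frame_comp_isStronglyOrthogonalQuadruple {s : Fin 4 → Fin 8} (hs : Function.Injective s) :
    IsStronglyOrthogonalQuadruple fun i => frame (s i) :=
  isStronglyOrthogonalQuadruple_iff.2 ⟨fun _ => frame_mem_roots _, fun i j hij => by
    simp [inner_frame_frame, hs.ne hij]⟩

theorem half_sum_frame_mem_roots :
    (1 / 2 : ℝ) • (frame 0 + frame 1 + frame 2 + frame 3) ∈ roots := by
  convert e_add_e_mem_roots (i := 0) (j := 2) (by decide) using 1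
  simp only [frame, Matrix.cons_val]
  module

theorem klein_frame_subset :
    klein (fun i => frame (![0, 1, 2, 3] i)) ⊆ (weylGroup : Set (V ≃ₗᵢ[ℝ] V)) := by
  rw [klein_subset_iff]
  have h := half_sum_frame_mem_roots
  refine ⟨?_, ?_, ?_⟩ <;>
    refine refl_mul_refl_mem_weylGroup (frame_mem_roots _) (frame_mem_roots _)
      (frame_mem_roots _) (frame_mem_roots _) ?_ ?_ ?_ ?_ ?_ ?_ ?_ <;>
    first
      | simp [inner_frame_frame]; done
      | convert h using 1; simp only [Matrix.cons_val] <;> module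

/-- The first double transposition sends the root `ζ_{0,1,2,4}` to `ζ_{0,1,2,4} - e 1`, whose inner
product with the original root is 3/2, so it is not a root. -/
theorem klein_frame_not_subset :
    ¬ klein (fun i => frame (![0, 1, 2, 4] i)) ⊆ (weylGroup : Set (V ≃ₗᵢ[ℝ] V)) := by
  rw [klein_subset_iff]
  rintro ⟨h, -, -⟩
  simp only [Matrix.cons_val] at h
  have hx : zeta {0, 1, 2, 4} ∈ roots := zeta_mem_roots (by decide)
  have h1 : refl (frame 2 - frame 4) (zeta {0, 1, 2, 4}) = zeta {0, 1, 2, 4} := by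
    apply refl_apply_of_inner_eq_zero
    rw [real_inner_comm, inner_sub_left]
    simp [frame, inner_e_add_e, zeta_apply]
  have h2 : refl (frame 0 - frame 1) (zeta {0, 1, 2, 4}) = zeta {0, 1, 2, 4} - e 1 := by
    have hf : frame 0 - frame 1 = (2 : ℝ) • e 1 := by
      simp only [frame, Matrix.cons_val]; module
    rw [refl_apply, hf, inner_smul_right, inner_smul_right, inner_smul_left, real_inner_comm,
      inner_e, inner_e, e_apply, zeta_apply]
    simp
  obtain ⟨n, hn⟩ := exists_int_inner_eq_of_mem_roots (weyl_mem_roots h _ hx) hx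
  rw [isometry_mul_apply, h1, h2, inner_sub_left, inner_self_of_mem_roots hx, inner_e,
    zeta_apply] at hn
  simp at hn
  have : (2 * n : ℤ) = 3 := by
    have : ((2 * n : ℤ) : ℝ) = 3 := by push_cast; linarith
    exact_mod_cast this
  omega

/-- The inner product with the root `ζ_{0,1,2,4}` is 1/2. -/
theorem half_sum_frame_not_mem_roots :
    (1 / 2 : ℝ) • (frame 0 + frame 1 + frame 2 + frame 4) ∉ roots := by
  intro h
  have hx : zeta {0, 1, 2, 4} ∈ roots := zeta_mem_roots (by decide)
  obtain ⟨n, hn⟩ := exists_int_inner_eq_of_mem_roots h hx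
  rw [inner_smul_left, inner_add_left, inner_add_left, inner_add_left] at hn
  simp [frame, inner_e_add_e, inner_e_sub_e, zeta_apply] at hn
  have : (2 * n : ℤ) = 1 := by
    have : ((2 * n : ℤ) : ℝ) = 1 := by push_cast; linarith
    exact_mod_cast this
  omega

/-- Every system of four strongly orthogonal roots can be moved to one of two standard ones. -/
theorem exists_weyl_eq_frame {α : Fin 4 → V} (hα : IsStronglyOrthogonalQuadruple α) :
    ∃ w ∈ weylGroup, (fun i => w (α i)) = (fun i => frame (![0, 1, 2, 3] i)) ∨
      (fun i => w (α i)) = fun i => frame (![0, 1, 2, 4] i) := by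
  rw [isStronglyOrthogonalQuadruple_iff] at hα
  obtain ⟨w, hw, h0, h1, h2, h3⟩ := exists_weyl_quadruple hα.1 hα.2
  refine ⟨w, hw, h3.imp (fun h3 => ?_) (fun h3 => ?_)⟩ <;>
  · ext1 i
    fin_cases i <;> assumption

theorem half_sum_mem_roots_iff {w : V ≃ₗᵢ[ℝ] V} (hw : w ∈ weylGroup) (α : Fin 4 → V) :
    (1 / 2 : ℝ) • ∑ i, w (α i) ∈ roots ↔ (1 / 2 : ℝ) • ∑ i, α i ∈ roots := by
  rw [← map_sum, ← map_smul, weyl_mem_roots_iff hw]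

/-- The Klein four-group of four orthogonal roots is in the Weyl group if and only if half the sum
of these roots is a root. -/
theorem klein_subset_iff_half_sum_mem {α : Fin 4 → V} (hα : IsStronglyOrthogonalQuadruple α) :
    klein α ⊆ (weylGroup : Set (V ≃ₗᵢ[ℝ] V)) ↔ (1 / 2 : ℝ) • ∑ i, α i ∈ roots := by
  obtain ⟨w, hw, h⟩ := exists_weyl_eq_frame hα
  -- Both conditions are invariant under the Weyl group, so they need comparing only on the two
  -- standard quadruples.
  rw [← klein_map_subset_iff hw, ← half_sum_mem_roots_iff hw]
  rcases h with h | h <;> simp only [funext_iff] at h <;> simp only [h, Fin.sum_univ_four]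
  · exact iff_of_true klein_frame_subset half_sum_frame_mem_roots
  · exact iff_of_false klein_frame_not_subset half_sum_frame_not_mem_roots

theorem IsStronglyOrthogonalQuadruple.injective {α : Fin 4 → V}
    (hα : IsStronglyOrthogonalQuadruple α) : Function.Injective α := fun i j h => by
  by_contra hij
  exact (hα.2 hij).1 h

/-! ### Equivalence of systems of four roots -/

theorem WeylEquivalent.symm {S T : Set V} (h : WeylEquivalent S T) : WeylEquivalent T S := by
  obtain ⟨w, hw, rfl⟩ := h
  refine ⟨w⁻¹, inv_mem hw, ?_⟩
  rw [← Set.image_comp, ← LinearIsometryEquiv.coe_mul, inv_mul_cancel]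
  exact Set.image_id S

theorem WeylEquivalent.trans {S T U : Set V} (h : WeylEquivalent S T) (h' : WeylEquivalent T U) :
    WeylEquivalent S U := by
  obtain ⟨w, hw, rfl⟩ := h
  obtain ⟨w', hw', rfl⟩ := h'
  exact ⟨w' * w, mul_mem hw' hw, by rw [LinearIsometryEquiv.coe_mul, Set.image_comp]⟩

theorem weylEquivalent_range_of_eq {α β : Fin 4 → V} {w : V ≃ₗᵢ[ℝ] V} (hw : w ∈ weylGroup)
    (h : (fun i => w (α i)) = β) : WeylEquivalent (Set.range α) (Set.range β) :=
  ⟨w, hw, by rw [← h, ← Set.range_comp]; rfl⟩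

theorem weylEquivalent_range_iff {α β : Fin 4 → V} (hα : IsStronglyOrthogonalQuadruple α)
    (hβ : IsStronglyOrthogonalQuadruple β) :
    WeylEquivalent (Set.range α) (Set.range β) ↔
      (klein α ⊆ (weylGroup : Set (V ≃ₗᵢ[ℝ] V)) ↔ klein β ⊆ (weylGroup : Set (V ≃ₗᵢ[ℝ] V))) := by
  constructor
  · rintro ⟨w, hw, h⟩
    rw [klein_subset_iff_half_sum_mem hα, klein_subset_iff_half_sum_mem hβ,
      ← half_sum_mem_roots_iff hw]
    -- An equivalence of sets need not respect the enumerations; writing the sums over the ranges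
    -- removes this dependence.
    have h1 := finsum_mem_range (f := fun x : V => x) (w.injective.comp hα.injective)
    have h2 := finsum_mem_range (f := fun x : V => x) hβ.injective
    rw [Set.range_comp, h, h2, finsum_eq_sum_of_fintype, finsum_eq_sum_of_fintype] at h1
    simp only [Function.comp_apply] at h1
    rw [h1]
  · intro h
    obtain ⟨w, hw, h1⟩ := exists_weyl_eq_frame hα
    obtain ⟨w', hw', h2⟩ := exists_weyl_eq_frame hβ
    rw [← klein_map_subset_iff hw α, ← klein_map_subset_iff hw' β] at h
    rcases h1 with h1 | h1 <;> rcases h2 with h2 | h2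
    · exact (weylEquivalent_range_of_eq hw h1).trans (weylEquivalent_range_of_eq hw' h2).symm
    · rw [h1, h2] at h
      exact absurd (h.1 klein_frame_subset) klein_frame_not_subset
    · rw [h1, h2] at h
      exact absurd (h.2 klein_frame_subset) klein_frame_not_subset
    · exact (weylEquivalent_range_of_eq hw h1).trans (weylEquivalent_range_of_eq hw' h2).symm

/-! ### Permutations and sign changes of the frame -/

/-- The permutations of the frame which are induced by elements of the Weyl group. -/
def framePerm : Submonoid (Equiv.Perm (Fin 8)) where
  carrier := {σ | ∃ w ∈ weylGroup, ∀ i, w (frame i) = frame (σ i)}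
  one_mem' := ⟨1, one_mem _, fun _ => rfl⟩
  mul_mem' := by
    rintro σ τ ⟨w, hw, h⟩ ⟨w', hw', h'⟩
    exact ⟨w * w', mul_mem hw hw', fun i => by
      rw [isometry_mul_apply, h', h, Equiv.Perm.mul_apply]⟩

/-- The vector `frame a - frame b` has squared norm 4, so this reflection is not itself a root
reflection; only suitable products of two such are used. -/
theorem refl_frame_sub_frame {a b : Fin 8} (hab : a ≠ b) (i : Fin 8) :
    refl (frame a - frame b) (frame i) = frame (Equiv.swap a b i) := by
  have hn : ⟪frame a - frame b, frame a - frame b⟫ = 4 := by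
    simp only [real_inner_sub_sub_self, inner_frame_frame, hab, if_true, if_false]; norm_num
  rw [refl_apply, hn, inner_sub_right, inner_frame_frame, inner_frame_frame]
  by_cases ha : i = a
  · subst ha
    simp [hab]; norm_num
  by_cases hb : i = b
  · subst hb
    simp [hab.symm]; norm_num
  simp [ha, hb, Equiv.swap_apply_of_ne_of_ne ha hb]

theorem swap_mul_swap_mem_framePerm {a b c d : Fin 8} (hab : a ≠ b) (hac : a ≠ c) (had : a ≠ d)
    (hbc : b ≠ c) (hbd : b ≠ d) (hcd : c ≠ d)
    (h : (1 / 2 : ℝ) • (frame a + frame b + frame c + frame d) ∈ roots) :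
    Equiv.swap a b * Equiv.swap c d ∈ framePerm := by
  refine ⟨refl (frame a - frame b) * refl (frame c - frame d), ?_, fun i => ?_⟩
  · refine refl_mul_refl_mem_weylGroup (frame_mem_roots _) (frame_mem_roots _)
      (frame_mem_roots _) (frame_mem_roots _) ?_ ?_ ?_ ?_ ?_ ?_ h <;>
      simp [inner_frame_frame, *]
  · rw [isometry_mul_apply, refl_frame_sub_frame hcd, refl_frame_sub_frame hab,
      Equiv.Perm.mul_apply]

/-- Some permutations of the frame which are induced by elements of the Weyl group. -/
def doubleSwaps : List (Equiv.Perm (Fin 8)) :=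
  [1, Equiv.swap 0 1 * Equiv.swap 6 7, Equiv.swap 2 4 * Equiv.swap 3 5,
    Equiv.swap 0 2 * Equiv.swap 5 7, Equiv.swap 1 4 * Equiv.swap 3 6]

theorem mem_framePerm_of_mem_doubleSwaps : ∀ σ ∈ doubleSwaps, σ ∈ framePerm := by
  simp only [doubleSwaps, List.forall_mem_cons, List.not_mem_nil, false_implies, implies_true,
    and_true]
  refine ⟨one_mem _, ?_, ?_, ?_, ?_⟩ <;>
    apply swap_mul_swap_mem_framePerm (by decide) (by decide) (by decide) (by decide) (by decide)
      (by decide)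
  · convert e_add_e_mem_roots (i := 0) (j := 6) (by decide) using 1
    simp only [frame, Matrix.cons_val]; module
  · convert e_add_e_mem_roots (i := 2) (j := 4) (by decide) using 1
    simp only [frame, Matrix.cons_val]; module
  · convert zeta_mem_roots (I := {0, 1, 2, 3, 4, 6}) (by decide) using 1
    ext i
    fin_cases i <;> simp [frame, zeta_apply, e_apply]
  · convert zeta_mem_roots (I := {0, 2, 4, 5, 6, 7}) (by decide) using 1
    ext i
    fin_cases i <;> simp [frame, zeta_apply, e_apply]

/-- A standard set of five to eight indices. -/
def standardIndices (k : ℕ) : Finset (Fin 8) := ([0, 1, 2, 4, 3, 5, 6, 7].take k).toFinset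

/-- A finite check over the 15 choices of `B`: words of length at most two suffice, shorter ones
being included because `doubleSwaps` contains 1. -/
theorem exists_doubleSwaps_map_eq : ∀ B ∈ ({3, 5, 6, 7} : Finset (Fin 8)).powerset, B.Nonempty →
    ∃ σ ∈ doubleSwaps, ∃ τ ∈ doubleSwaps,
      ({0, 1, 2, 4} ∪ B).image (fun i => σ (τ i)) = standardIndices (({0, 1, 2, 4} ∪ B).card) := by
  decide +kernel

theorem weylEquivalent_frame_standardIndices {A : Finset (Fin 8)} (hA : {0, 1, 2, 4} ⊆ A)
    (hc : 5 ≤ A.card) :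
    WeylEquivalent (frame '' A) (frame '' (standardIndices A.card)) := by
  have hAB : {0, 1, 2, 4} ∪ A \ {0, 1, 2, 4} = A := Finset.union_sdiff_of_subset hA
  obtain ⟨σ, hσ, τ, hτ, h⟩ := exists_doubleSwaps_map_eq (A \ {0, 1, 2, 4})
    (by
      rw [Finset.mem_powerset]
      refine (Finset.sdiff_subset_sdiff (Finset.subset_univ A) subset_rfl).trans ?_
      decide)
    (by
      rw [Finset.sdiff_nonempty]
      intro hs
      have := Finset.card_le_card hs
      have h4 : ({0, 1, 2, 4} : Finset (Fin 8)).card = 4 := rfl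
      omega)
  rw [hAB] at h
  obtain ⟨w, hw, hwf⟩ := mul_mem (mem_framePerm_of_mem_doubleSwaps σ hσ)
    (mem_framePerm_of_mem_doubleSwaps τ hτ)
  refine ⟨w, hw, ?_⟩
  rw [← h, Finset.coe_image, ← Set.image_comp, ← Set.image_comp]
  exact Set.image_congr fun i _ => hwf i

theorem exists_weyl_neg_frame (J : Finset (Fin 8)) :
    ∃ w ∈ weylGroup, ∀ i, w (frame i) = if i ∈ J then -frame i else frame i := by
  induction J using Finset.induction_on with
  | empty => exact ⟨1, one_mem _, fun i => by simp⟩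
  | insert j J hj ih =>
    obtain ⟨w, hw, h⟩ := ih
    refine ⟨refl (frame j) * w, mul_mem (refl_mem_weylGroup (frame_mem_roots j)) hw, fun i => ?_⟩
    rw [isometry_mul_apply, h]
    by_cases hij : i = j
    · subst hij
      simp [hj, refl_self _ (frame_mem_roots i)]
    · have : refl (frame j) (frame i) = frame i :=
        refl_apply_of_inner_eq_zero (by simp [inner_frame_frame, hij])
      simp only [Finset.mem_insert, hij, false_or]
      split_ifs
      · rw [map_neg, this]
      · exact this

/-- A set of pairwise orthogonal vectors each of which is, up to sign, in the frame is equivalent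
to a subset of the frame. -/
theorem weylEquivalent_frame_image {T : Set V} (ho : T.Pairwise fun x y => ⟪x, y⟫ = 0)
    (hT : ∀ x ∈ T, ∃ i, x = frame i ∨ x = -frame i) :
    WeylEquivalent T (frame '' {i | frame i ∈ T ∨ -frame i ∈ T}) := by
  classical
  obtain ⟨w, hw, h⟩ := exists_weyl_neg_frame (Finset.univ.filter fun i => -frame i ∈ T)
  simp only [Finset.mem_filter, Finset.mem_univ, true_and] at h
  have hpos : ∀ i, frame i ∈ T → w (frame i) = frame i := by
    intro i hi
    rw [h, if_neg]
    -- Orthogonality forbids `T` to contain both `frame i` and `-frame i`, so no vector already in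
    -- the frame has its sign changed.
    intro hn
    have h2 := inner_frame_frame i i
    have h0 : ⟪frame i, -frame i⟫ = 0 := ho hi hn fun he => by
      have h3 : ⟪frame i, frame i⟫ = ⟪frame i, -frame i⟫ := by rw [← he]
      rw [inner_neg_right, h2] at h3
      norm_num at h3
    rw [inner_neg_right, h2] at h0
    norm_num at h0
  have hneg : ∀ i, -frame i ∈ T → w (-frame i) = frame i := by
    intro i hi
    rw [map_neg, h, if_pos hi, neg_neg]
  refine ⟨w, hw, Set.Subset.antisymm ?_ ?_⟩
  · rintro _ ⟨x, hx, rfl⟩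
    obtain ⟨i, rfl | rfl⟩ := hT x hx
    · exact ⟨i, Or.inl hx, (hpos i hx).symm⟩
    · exact ⟨i, Or.inr hx, (hneg i hx).symm⟩
  · rintro _ ⟨i, hi | hi, rfl⟩
    · exact ⟨_, hi, hpos i hi⟩
    · exact ⟨_, hi, hneg i hi⟩

/-! ### Normal forms for systems of size other than four -/

theorem weylEquivalent_ncard {S T : Set V} (h : WeylEquivalent S T) : S.ncard = T.ncard := by
  obtain ⟨w, -, rfl⟩ := h
  exact (Set.ncard_image_of_injective S w.injective).symm

/-- Systems of at least five orthogonal roots are equivalent to standard ones. -/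
theorem weylEquivalent_standard_of_five_le {S : Finset V} (hS : (S : Set V) ⊆ roots)
    (ho : (S : Set V).Pairwise fun x y => ⟪x, y⟫ = 0) (hc : 5 ≤ S.card) :
    WeylEquivalent S (frame '' (standardIndices S.card)) := by
  classical
  obtain ⟨R, hRS, hR⟩ := Finset.exists_subset_card_eq (s := S) (n := 3) (by omega)
  have hd : 1 < (S \ R).card := by
    rw [Finset.card_sdiff_of_subset hRS]; omega
  obtain ⟨x, y, z, hxy, hxz, hyz, rfl⟩ := Finset.card_eq_three.1 hR
  simp only [Finset.insert_subset_iff, Finset.singleton_subset_iff] at hRS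
  obtain ⟨hx, hy, hz⟩ := hRS
  obtain ⟨w, hw, h0, h1, h2⟩ := exists_weyl_triple (hS hx) (hS hy) (hS hz) (ho hx hy hxy)
    (ho hx hz hxz) (ho hy hz hyz)
  have key : ∀ d ∈ S \ {x, y, z}, w d = frame 3 ∨ w d = -frame 3 ∨ ∃ w ∈ weylGroup,
      w x = frame 0 ∧ w y = frame 1 ∧ w z = frame 2 ∧ w d = frame 4 := by
    intro d hd
    simp only [Finset.mem_sdiff, Finset.mem_insert, Finset.mem_singleton, not_or] at hd
    obtain ⟨hd, hdx, hdy, hdz⟩ := hd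
    refine (eq_or_eq_neg_frame_three_or_exists_weyl_frame_four (weyl_mem_roots hw d (hS hd))
      ?_ ?_ ?_).imp id (Or.imp id ?_)
    · rw [← h0, LinearIsometryEquiv.inner_map_map, ho hx hd (Ne.symm hdx)]
    · rw [← h1, LinearIsometryEquiv.inner_map_map, ho hy hd (Ne.symm hdy)]
    · rw [← h2, LinearIsometryEquiv.inner_map_map, ho hz hd (Ne.symm hdz)]
    · rintro ⟨w', hw', g0, g1, g2, g4⟩
      exact ⟨w' * w, mul_mem hw' hw, by rw [isometry_mul_apply, h0, g0],
        by rw [isometry_mul_apply, h1, g1], by rw [isometry_mul_apply, h2, g2],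
        by rw [isometry_mul_apply, g4]⟩
  obtain ⟨d, hdS, w, hw, h0, h1, h2, h4⟩ : ∃ d ∈ S, ∃ w ∈ weylGroup,
      w x = frame 0 ∧ w y = frame 1 ∧ w z = frame 2 ∧ w d = frame 4 := by
    -- Of two orthogonal roots outside the triple, at most one can be sent to `± frame 3`; the other
    -- lies in D₄ and can be moved to `frame 4`.
    obtain ⟨d, hd, d', hd', hdd⟩ := Finset.one_lt_card.1 hd
    have hin : ⟪w d, w d'⟫ = 0 := by
      rw [LinearIsometryEquiv.inner_map_map]
      exact ho (Finset.mem_sdiff.1 hd).1 (Finset.mem_sdiff.1 hd').1 hdd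
    have := inner_frame_frame 3 3
    rcases key d hd with h | h | h
    · rcases key d' hd' with h' | h' | h'
      · rw [h, h', this] at hin; norm_num at hin
      · rw [h, h', inner_neg_right, this] at hin; norm_num at hin
      · exact ⟨d', (Finset.mem_sdiff.1 hd').1, h'⟩
    · rcases key d' hd' with h' | h' | h'
      · rw [h, h', inner_neg_left, this] at hin; norm_num at hin
      · rw [h, h', inner_neg_neg, this] at hin; norm_num at hin
      · exact ⟨d', (Finset.mem_sdiff.1 hd').1, h'⟩
    · exact ⟨d, (Finset.mem_sdiff.1 hd).1, h⟩
  have hT : WeylEquivalent S (w '' S) := ⟨w, hw, rfl⟩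
  have hTo : (w '' S).Pairwise fun x y => ⟪x, y⟫ = 0 := by
    rintro _ ⟨a, ha, rfl⟩ _ ⟨b, hb, rfl⟩ hab
    rw [LinearIsometryEquiv.inner_map_map]
    exact ho ha hb fun h => hab (by rw [h])
  have m0 : frame 0 ∈ w '' S := ⟨x, hx, h0⟩
  have m1 : frame 1 ∈ w '' S := ⟨y, hy, h1⟩
  have m2 : frame 2 ∈ w '' S := ⟨z, hz, h2⟩
  have m4 : frame 4 ∈ w '' S := ⟨d, hdS, h4⟩
  have hTf : ∀ v ∈ w '' S, ∃ i, v = frame i ∨ v = -frame i := by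
    intro v hv
    -- Frame vectors are set aside first because orthogonality holds only between distinct members
    -- of the system.
    by_cases hvi : ∃ i, v = frame i
    · exact hvi.imp fun i => Or.inl
    push Not at hvi
    refine exists_eq_frame_of_inner_eq_zero ?_ (hTo m0 hv (hvi 0).symm) (hTo m1 hv (hvi 1).symm)
      (hTo m2 hv (hvi 2).symm) (hTo m4 hv (hvi 4).symm)
    obtain ⟨a, ha, rfl⟩ := hv
    exact weyl_mem_roots hw a (hS ha)
  have hTA := hT.trans (weylEquivalent_frame_image hTo hTf)
  set A : Finset (Fin 8) :=
    Finset.univ.filter fun i => frame i ∈ w '' S ∨ -frame i ∈ w '' S with hA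
  have hAc : {i | frame i ∈ w '' S ∨ -frame i ∈ w '' S} = (A : Set (Fin 8)) := by simp [hA]
  rw [hAc] at hTA
  have hcard : S.card = A.card := by
    have := weylEquivalent_ncard hTA
    rwa [Set.ncard_image_of_injective _ frame_injective, Set.ncard_coe_finset,
      Set.ncard_coe_finset] at this
  have hsub : {0, 1, 2, 4} ⊆ A := by
    simp only [Finset.insert_subset_iff, Finset.singleton_subset_iff, hA, Finset.mem_filter,
      Finset.mem_univ, true_and]
    exact ⟨Or.inl m0, Or.inl m1, Or.inl m2, Or.inl m4⟩
  rw [hcard]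
  exact hTA.trans (weylEquivalent_frame_standardIndices hsub (by omega))

theorem weylEquivalent_standard_of_le_three {S : Finset V} (hS : (S : Set V) ⊆ roots)
    (ho : (S : Set V).Pairwise fun x y => ⟪x, y⟫ = 0) (hc : S.card ≤ 3) :
    WeylEquivalent S (frame '' (standardIndices S.card)) := by
  classical
  have hcases : S.card = 0 ∨ S.card = 1 ∨ S.card = 2 ∨ S.card = 3 := by omega
  rcases hcases with h | h | h | h
  · rw [h, Finset.card_eq_zero.1 h]
    exact ⟨1, one_mem _, by simp [standardIndices]⟩
  · rw [h]
    obtain ⟨x, rfl⟩ := Finset.card_eq_one.1 h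
    obtain ⟨w, hw, h0⟩ := exists_weyl_frame_zero (hS (by simp : x ∈ _))
    exact ⟨w, hw, by simp [standardIndices, h0]⟩
  · rw [h]
    obtain ⟨x, y, hxy, rfl⟩ := Finset.card_eq_two.1 h
    have hx : x ∈ (({x, y} : Finset V) : Set V) := by simp
    have hy : y ∈ (({x, y} : Finset V) : Set V) := by simp
    obtain ⟨w, hw, h0⟩ := exists_weyl_frame_zero (hS hx)
    obtain ⟨w', hw', h0', h1⟩ := exists_weyl_frame_one (weyl_mem_roots hw _ (hS hy))
      (by rw [← h0, LinearIsometryEquiv.inner_map_map, ho hx hy hxy])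
    refine ⟨w' * w, mul_mem hw' hw, ?_⟩
    simp [standardIndices, Set.image_insert_eq, isometry_mul_apply, h0, h0', h1,
      -LinearIsometryEquiv.coe_mul]
  · rw [h]
    obtain ⟨x, y, z, hxy, hxz, hyz, rfl⟩ := Finset.card_eq_three.1 h
    have hx : x ∈ (({x, y, z} : Finset V) : Set V) := by simp
    have hy : y ∈ (({x, y, z} : Finset V) : Set V) := by simp
    have hz : z ∈ (({x, y, z} : Finset V) : Set V) := by simp
    obtain ⟨w, hw, h0, h1, h2⟩ := exists_weyl_triple (hS hx) (hS hy) (hS hz) (ho hx hy hxy)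
      (ho hx hz hxz) (ho hy hz hyz)
    refine ⟨w, hw, ?_⟩
    simp [standardIndices, Set.image_insert_eq, h0, h1, h2]

theorem IsStronglyOrthogonalSystem.weylEquivalent_standard {S : Finset V}
    (hS : IsStronglyOrthogonalSystem S) (hc : S.card ≠ 4) :
    WeylEquivalent S (frame '' (standardIndices S.card)) := by
  have ho : (S : Set V).Pairwise fun x y => ⟪x, y⟫ = 0 := fun x hx y hy hxy =>
    (stronglyOrthogonal_iff (hS.1 hx) (hS.1 hy)).1 (hS.2 hx hy hxy)
  rcases le_or_gt S.card 3 with h | h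
  · exact weylEquivalent_standard_of_le_three hS.1 ho h
  · exact weylEquivalent_standard_of_five_le hS.1 ho (by omega)

end E8

theorem mainTheorem12 :
    (∀ k : ℕ, k ≠ 4 → ∀ S T : Finset E8.V,
      E8.IsStronglyOrthogonalSystem S → S.card = k →
      E8.IsStronglyOrthogonalSystem T → T.card = k →
      E8.WeylEquivalent (S : Set E8.V) (T : Set E8.V)) ∧
    (∀ α β : Fin 4 → E8.V,
      E8.IsStronglyOrthogonalQuadruple α → E8.IsStronglyOrthogonalQuadruple β →
      (E8.WeylEquivalent (Set.range α) (Set.range β) ↔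
        (E8.klein α ⊆ (E8.weylGroup : Set (E8.V ≃ₗᵢ[ℝ] E8.V)) ↔
          E8.klein β ⊆ (E8.weylGroup : Set (E8.V ≃ₗᵢ[ℝ] E8.V))))) ∧
    (∃ α : Fin 4 → E8.V, E8.IsStronglyOrthogonalQuadruple α ∧
      E8.klein α ⊆ (E8.weylGroup : Set (E8.V ≃ₗᵢ[ℝ] E8.V))) ∧
    (∃ α : Fin 4 → E8.V, E8.IsStronglyOrthogonalQuadruple α ∧
      ¬ E8.klein α ⊆ (E8.weylGroup : Set (E8.V ≃ₗᵢ[ℝ] E8.V))) := by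
  refine ⟨fun k hk S T hS hSk hT hTk => ?_, fun α β hα hβ => E8.weylEquivalent_range_iff hα hβ,
    ⟨_, E8.frame_comp_isStronglyOrthogonalQuadruple (by decide), E8.klein_frame_subset⟩,
    ⟨_, E8.frame_comp_isStronglyOrthogonalQuadruple (by decide), E8.klein_frame_not_subset⟩⟩
  have h1 := hS.weylEquivalent_standard (hSk ▸ hk)
  have h2 := hT.weylEquivalent_standard (hTk ▸ hk)
  rw [hSk] at h1
  rw [hTk] at h2
  exact h1.trans h2.symm
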